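/- Let $0\le k\le n$ be integers, let $\mathcal S(\mathbb R^n)$ be the space of complex-valued Schwartz functions and $\mathcal S'(\mathbb R^n)$ the space of tempered distributions (continuous $\mathbb C$-linear functionals on $\mathcal S(\mathbb R^n)$) with the weak-* topology. For a Schwartz function $f$ let $T_f$ be the distribution $\langle T_f,\phi\rangle=\int f\phi$. For $g\in\mathcal S'(\mathbb R^k)$ let $g\otimes\delta^{n-k}\in\mathcal S'(\mathbb R^n)$ be the distribution $\langle g\otimes\delta^{n-k},\phi\rangle=\langle g,\phi(\cdot,0)\rangle$, and for $T\in\mathcal S'(\mathbb R^n)$ and an orthogonal matrix $U$ let $\langle T_U,\phi\rangle=\langle T,\phi(U^{T}\,\cdot)\rangle$. Put $$\mathcal G_k=\{(T_f\otimes\delta^{n-k})_U : f\in\mathcal S(\mathbb R^k),\ U^TU=I_n\},\qquad \mathcal G'_k=\{(f\otimes\delta^{n-k})_U : f\in\mathcal S'(\mathbb R^k),\ U^TU=I_n\}.$$ Let $M:\mathbb R^n\times\mathbb R^n\to\mathbb C$ satisfy the following conditions, where $O(M)[f](x)=\int_{\mathbb R^n}M(x,y)f(y)\,dy$: 1. for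 every $f\in L_2(\mathbb R^n)$ the integral $O(M)[f](x)$ converges absolutely for every $x$, and $O(M)[f]\in L_2(\mathbb R^n)$; 2. $M(y,x)=\overline{M(x,y)}$ for all $x,y$, and $\langle f,O(M)[f]\rangle_{L_2}>0$ for every nonzero $f\in L_2(\mathbb R^n)$; 3. $M(x,\cdot)$ and $M(\cdot,x)$ belong to $\mathcal S(\mathbb R^n)$ for every $x$, and $M$ is bounded; 4. the set of Schwartz functions that lie in the range of $O(M):L_2(\mathbb R^n)\to L_2(\mathbb R^n)$ is dense in $\mathcal S(\mathbb R^n)$. (Every proper kernel satisfies these conditions; a proper kernel is such an $M$ for which, in addition, for all multi-indices $\alpha,\beta$ one has $|x^\alpha\partial^x_\beta M(x,y)|<\gamma_{\alpha,\beta}(y)$ with some $\gamma_{\alpha,\beta}\in L_p(\mathbb R^n)$, $p\ge1$. So do the kernels $M(x,y)=\zeta(x-y)$ with $\zeta\in\mathcal S(\mathbb R^n)$, $\hat\zeta>0$.) For $f\in\mathcal S(\mathbb R^n)$ let $M_f$ be the real symmetric positive semidefinite $n\times n$ matrix with entries $$(M_f)_{ij}=\operatorname{Re}\iint_{\mathbb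 R^n\times\mathbb R^n}\overline{x_if(x)}\,M(x,y)\,y_jf(y)\,dx\,dy ,$$ let $R(f)=\|M_f\|_{n-k}$ be its Ky Fan $(n-k)$-anti-norm, that is, the sum of its $n-k$ smallest eigenvalues counted with multiplicity, and let $\Omega_\epsilon=\{f\in\mathcal S(\mathbb R^n): R(f)\le\epsilon\}$. **Theorem.** (i) For every $\epsilon>0$, $\mathcal G_k$ is contained in the weak-* sequential closure of $\{T_g: g\in\Omega_\epsilon\}$, i.e. every element of $\mathcal G_k$ is the weak-* limit of a sequence $T_{g_s}$ with $g_s\in\Omega_\epsilon$. (ii) If $(f_s)$ is a sequence in $\mathcal S(\mathbb R^n)$ and $T\in\mathcal S'(\mathbb R^n)$ are such that $T_{f_s}\to T$ weak-*, $R(f_s)\to0$ and $\operatorname{Tr}M_{f_s}$ is bounded, then $T\in\mathcal G'_k$. -/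

import Mathlib

open MeasureTheory Filter Topology
open scoped SchwartzMap ComplexConjugate ComplexOrder ENNReal

namespace LowDim

/-- Euclidean space `ℝⁿ`. -/
abbrev Rn (n : ℕ) : Type := EuclideanSpace ℝ (Fin n)

/-! ### Distributions carried by `k`-dimensional subspaces -/

/-- The isometric embedding `ℝᵏ → ℝⁿ`, `x ↦ (x, 0)`, for `k ≤ n`. -/
noncomputable def padZero {k n : ℕ} (hk : k ≤ n) : Rn k →ₗᵢ[ℝ] Rn n where
  toFun x := WithLp.toLp 2 fun i : Fin n => if h : (i : ℕ) < k then x ⟨i, h⟩ else 0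
  map_add' x y := by
    ext i
    by_cases h : (i : ℕ) < k <;> simp [h]
  map_smul' c x := by
    ext i
    by_cases h : (i : ℕ) < k <;> simp [h]
  norm_map' x := by
    obtain ⟨m, rfl⟩ := Nat.exists_eq_add_of_le hk
    simp [EuclideanSpace.norm_eq, Fin.sum_univ_add]

/-- Restriction of a Schwartz function to the first `k` coordinates:
`φ ↦ (x ↦ φ (x, 0))`. -/
noncomputable def restrictFirst {k n : ℕ} (hk : k ≤ n) : 𝓢(Rn n, ℂ) →L[ℂ] 𝓢(Rn k, ℂ) :=
  SchwartzMap.compCLMOfAntilipschitz ℂ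
    (padZero hk).toContinuousLinearMap.hasTemperateGrowth (padZero hk).isometry.antilipschitz

/-- The tensor product `g ⊗ δ^{n-k}` of `g ∈ 𝓢'(ℝᵏ)` with the Dirac distribution at the origin
of `ℝ^{n-k}`, that is `⟨g ⊗ δ^{n-k}, φ⟩ = ⟨g, φ(·, 0)⟩`. -/
noncomputable def tensorDelta {k n : ℕ} (hk : k ≤ n) (g : 𝓢'(Rn k, ℂ)) : 𝓢'(Rn n, ℂ) :=
  PointwiseConvergenceCLM.precomp ℂ (restrictFirst hk) g

theorem tensorDelta_apply {k n : ℕ} (hk : k ≤ n) (g : 𝓢'(Rn k, ℂ)) (φ : 𝓢(Rn n, ℂ)) :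
    tensorDelta hk g φ = g (restrictFirst hk φ) := rfl

theorem restrictFirst_apply {k n : ℕ} (hk : k ≤ n) (φ : 𝓢(Rn n, ℂ)) (x : Rn k) :
    restrictFirst hk φ x = φ (padZero hk x) := rfl

/-- The defining property of the tensor product: if `φ = φ₁ ⊗ φ₂` then
`⟨g ⊗ δ^{n-k}, φ⟩ = ⟨g, φ₁⟩ φ₂(0)`. -/
theorem tensorDelta_tmul {k m : ℕ} (g : 𝓢'(Rn k, ℂ)) (φ : 𝓢(Rn (k + m), ℂ))
    (φ₁ : 𝓢(Rn k, ℂ)) (φ₂ : 𝓢(Rn m, ℂ))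
    (hφ : ∀ x : Rn (k + m), φ x =
      φ₁ (WithLp.toLp 2 fun i => x (Fin.castAdd m i)) *
        φ₂ (WithLp.toLp 2 fun i => x (Fin.natAdd k i))) :
    tensorDelta (Nat.le_add_right k m) g φ = g φ₁ * φ₂ 0 := by
  have h : restrictFirst (Nat.le_add_right k m) φ = φ₂ 0 • φ₁ := by
    ext x
    rw [restrictFirst_apply, hφ]
    have h₁ : (WithLp.toLp 2 fun i => padZero (Nat.le_add_right k m) x (Fin.castAdd m i)) = x := by
      ext i; simp [padZero]
    have h₂ : (WithLp.toLp 2 fun i => padZero (Nat.le_add_right k m) x (Fin.natAdd k i)) =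
        (0 : Rn m) := by
      ext i; simp [padZero]
    rw [h₁, h₂]
    simp [mul_comm]
  rw [tensorDelta_apply, h, map_smul, smul_eq_mul, mul_comm]

/-- The orthogonal change of variables `g ↦ g_U`, `⟨g_U, φ⟩ = ⟨g, ψ⟩` with `ψ(x) = φ(Uᵀ x)`.
The orthogonal matrix `U` is given as a linear isometry of `ℝⁿ`, so `Uᵀ = U⁻¹ = U.symm`. -/
noncomputable def rotate {n : ℕ} (U : Rn n ≃ₗᵢ[ℝ] Rn n) (g : 𝓢'(Rn n, ℂ)) : 𝓢'(Rn n, ℂ) :=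
  PointwiseConvergenceCLM.precomp ℂ
    (SchwartzMap.compCLMOfContinuousLinearEquiv ℂ U.symm.toContinuousLinearEquiv) g

/-- The regular distribution `T_f`, `⟨T_f, φ⟩ = ∫ f φ`, of a Schwartz function `f`. -/
noncomputable def regular {n : ℕ} (f : 𝓢(Rn n, ℂ)) : 𝓢'(Rn n, ℂ) :=
  SchwartzMap.toTemperedDistributionCLM (Rn n) ℂ volume f

/-- `𝒢_k = {(T_f ⊗ δ^{n-k})_U | f ∈ 𝓢(ℝᵏ), U orthogonal}`. -/
def G {k n : ℕ} (hk : k ≤ n) : Set 𝓢'(Rn n, ℂ) :=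
  {T | ∃ (f : 𝓢(Rn k, ℂ)) (U : Rn n ≃ₗᵢ[ℝ] Rn n), T = rotate U (tensorDelta hk (regular f))}

/-- `𝒢'_k = {(f ⊗ δ^{n-k})_U | f ∈ 𝓢'(ℝᵏ), U orthogonal}`. -/
def G' {k n : ℕ} (hk : k ≤ n) : Set 𝓢'(Rn n, ℂ) :=
  {T | ∃ (f : 𝓢'(Rn k, ℂ)) (U : Rn n ≃ₗᵢ[ℝ] Rn n), T = rotate U (tensorDelta hk f)}

/-! ### Kernels -/

/-- The integral operator `O(M)[f](x) = ∫ M(x, y) f(y) dy`. -/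
noncomputable def integralOp {n : ℕ} (M : Rn n → Rn n → ℂ) (f : Rn n → ℂ) : Rn n → ℂ :=
  fun x => ∫ y, M x y * f y

/-- A kernel: `O(M)` is an everywhere defined operator on `L₂(ℝⁿ)`, `M` is conjugate symmetric,
and `⟨f, O(M)[f]⟩ > 0` for every nonzero `f ∈ L₂(ℝⁿ)`. -/
structure IsKernel {n : ℕ} (M : Rn n → Rn n → ℂ) : Prop where
  integrable : ∀ f : Rn n → ℂ, MemLp f 2 volume → ∀ x, Integrable (fun y => M x y * f y)
  memLp : ∀ f : Rn n → ℂ, MemLp f 2 volume → MemLp (integralOp M f) 2 volume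
  conj_symm : ∀ x y, M y x = conj (M x y)
  pos : ∀ f : Rn n → ℂ, MemLp f 2 volume → ¬ f =ᵐ[volume] 0 →
    0 < ∫ x, conj (f x) * integralOp M f x

/-- A kernel which is a Schwartz function of each variable, is bounded, and for which
`ℛ[O(M)] ∩ 𝓢(ℝⁿ)` is dense in `𝓢(ℝⁿ)`. -/
structure IsRegularKernel {n : ℕ} (M : Rn n → Rn n → ℂ) : Prop extends IsKernel M where
  schwartz_right : ∀ x, ∃ ψ : 𝓢(Rn n, ℂ), ∀ y, ψ y = M x y
  schwartz_left : ∀ y, ∃ ψ : 𝓢(Rn n, ℂ), ∀ x, ψ x = M x y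
  bounded : ∃ γ : ℝ, ∀ x y, ‖M x y‖ ≤ γ
  dense_range : Dense {ψ : 𝓢(Rn n, ℂ) |
    ∃ φ : Rn n → ℂ, MemLp φ 2 volume ∧ ψ =ᵐ[volume] integralOp M φ}

/-- The partial derivative `∂f/∂x_i`. -/
noncomputable def pderiv {n : ℕ} (i : Fin n) (f : Rn n → ℂ) : Rn n → ℂ :=
  fun x => fderiv ℝ f x (EuclideanSpace.single i 1)

/-- The partial derivative `∂_β f` for a multi-index `β`. -/
noncomputable def multiDeriv {n : ℕ} (β : Fin n → ℕ) (f : Rn n → ℂ) : Rn n → ℂ :=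
  (List.finRange n).foldr (fun i g => (pderiv i)^[β i] g) f

/-- A proper kernel: a regular kernel with in addition `|x^α ∂^x_β M(x, y)| < γ_{α,β}(y)` for some
`γ_{α,β} ∈ L_p(ℝⁿ)`, `p ≥ 1`. Proper kernels are a special case of regular kernels; the latter
also include the kernels `ζ(x - y)`, `ζ ∈ 𝓢(ℝⁿ)` with positive Fourier transform, which for `n ≥ 1`
do not satisfy the additional bound. -/
structure IsProperKernel {n : ℕ} (M : Rn n → Rn n → ℂ) : Prop extends IsRegularKernel M where
  decay : ∀ α β : Fin n → ℕ, ∃ (p : ℝ≥0∞) (γ : Rn n → ℝ), 1 ≤ p ∧ MemLp γ p volume ∧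
    ∀ x y, ‖((∏ i, x i ^ α i : ℝ) : ℂ) * multiDeriv β (fun x' => M x' y) x‖ < γ y

/-- `⟨f | M | g⟩ = ∬ f(x)^* M(x, y) g(y) dx dy`. -/
noncomputable def kernelForm {n : ℕ} (M : Rn n → Rn n → ℂ) (f g : Rn n → ℂ) : ℂ :=
  ∫ z : Rn n × Rn n, conj (f z.1) * M z.1 z.2 * g z.2

/-- The matrix `M_f = [Re ⟨x_i f | M | x_j f⟩]`. -/
noncomputable def gram {n : ℕ} (M : Rn n → Rn n → ℂ) (f : Rn n → ℂ) :
    Matrix (Fin n) (Fin n) ℝ :=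
  Matrix.of fun i j =>
    (kernelForm M (fun x => (x i : ℂ) * f x) (fun x => (x j : ℂ) * f x)).re

theorem gram_isHermitian {n : ℕ} {M : Rn n → Rn n → ℂ} (hM : IsKernel M) (f : Rn n → ℂ) :
    (gram M f).IsHermitian := by
  ext i j
  simp only [Matrix.conjTranspose_apply, gram, Matrix.of_apply, star_trivial, kernelForm]
  rw [← Complex.conj_re, ← integral_conj, Measure.volume_eq_prod, ← integral_prod_swap]
  congr 2
  ext z
  simp only [map_mul, Complex.conj_conj, Prod.fst_swap, Prod.snd_swap, ← hM.conj_symm]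
  ring

/-- The Ky Fan `m`-anti-norm: the sum of the `m` smallest eigenvalues, counted with multiplicity
(`hA.eigenvalues₀ 0 ≥ hA.eigenvalues₀ 1 ≥ …` lists the eigenvalues in decreasing order). -/
noncomputable def antiNorm {n : ℕ} (m : ℕ) {A : Matrix (Fin n) (Fin n) ℝ}
    (hA : A.IsHermitian) : ℝ :=
  ∑ i : Fin (Fintype.card (Fin n)), if n ≤ (i : ℕ) + m then hA.eigenvalues₀ i else 0

/-- `R(f) = ‖M_f‖_{n-k}`. -/
noncomputable def R {n : ℕ} (k : ℕ) {M : Rn n → Rn n → ℂ} (hM : IsKernel M)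
    (f : 𝓢(Rn n, ℂ)) : ℝ :=
  antiNorm (n - k) (gram_isHermitian hM f)

/-- `Ω_ε = {f ∈ 𝓢(ℝⁿ) | R(f) ≤ ε}`. -/
def Omega {n : ℕ} (k : ℕ) {M : Rn n → Rn n → ℂ} (hM : IsKernel M) (ε : ℝ) :
    Set 𝓢(Rn n, ℂ) :=
  {f | R k hM f ≤ ε}

end LowDim

/-!
For (ii), let `v` be one of the last `n - k` vectors of an orthonormal eigenbasis of `M_{f_s}`. Then
`⟨v·x f_s | M | v·x f_s⟩ ≤ R(f_s) → 0`, so Cauchy–Schwarz for the positive operator `O(M)` gives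
`⟨O(M) φ, v·x f_s⟩ → 0` for each `φ ∈ L₂`. Letting the bases converge and using that
`ℛ[O(M)] ∩ 𝓢` is dense, one gets `(v·x) T = 0` for the last `n - k` vectors `v` of the limiting
basis. In the coordinates `(x, y)` of that basis `T` is killed by every `y_j`. If `Γ(0) = 1`,
integrating the `t`-derivative of `φ(x, ty) Γ((1 - t)y)` over `[0, 1]` writes
`φ - φ(·, 0) ⊗ Γ` as a combination `∑ y_j h_j` with Schwartz `h_j`, hence
`⟨T, φ⟩ = ⟨T, φ(·, 0) ⊗ Γ⟩`, that is `T = g ⊗ δ` with `⟨g, f⟩ = ⟨T, f ⊗ Γ⟩`.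

For (i), `f ⊗ δ` is the limit of `f(x) s^{n-k} Γ(s y)` with `∫ Γ = 1`. Multiplied by `y_j`, these
functions have `L₁` norm `O(1/s)`, so for bounded `M` the diagonal entries of the last `n - k`
coordinates in `M_f` are `O(1/s²)`, and by Ky Fan's principle their sum dominates `R`.
-/

namespace LowDim

section PositiveOperator

variable {𝕜 E : Type*} [RCLike 𝕜] [NormedAddCommGroup E] [InnerProductSpace 𝕜 E] {T : E →ₗ[𝕜] E}

theorem norm_inner_map_sq_le_of_isPositive (hT : T.IsPositive) (x y : E) :
    ‖inner 𝕜 (T x) y‖ ^ 2 ≤ RCLike.re (inner 𝕜 (T x) x) * RCLike.re (inner 𝕜 (T y) y) := by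
  let core : PreInnerProductSpace.Core 𝕜 E :=
    { inner x y := inner 𝕜 (T x) y
      conj_inner_symm x y := by rw [inner_conj_symm, ← hT.isSymmetric]
      re_inner_nonneg := hT.re_inner_nonneg_left
      add_left x y z := by rw [map_add, inner_add_left]
      smul_left x y c := by rw [map_smul, inner_smul_left] }
  have h := @InnerProductSpace.Core.inner_mul_inner_self_le 𝕜 E _ _ _ core x y
  rwa [@InnerProductSpace.Core.norm_inner_symm 𝕜 E _ _ _ core y x, ← sq] at h

variable [FiniteDimensional 𝕜 E] {n : ℕ}

theorem re_inner_map_self_eq_sum_eigenvalues_mul (hT : T.IsSymmetric)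
    (hn : Module.finrank 𝕜 E = n) (x : E) :
    RCLike.re (inner 𝕜 (T x) x) =
      ∑ i, hT.eigenvalues hn i * ‖inner 𝕜 (hT.eigenvectorBasis hn i) x‖ ^ 2 := by
  rw [← (hT.eigenvectorBasis hn).sum_inner_mul_inner, map_sum]
  refine Finset.sum_congr rfl fun i _ => ?_
  rw [hT, hT.apply_eigenvectorBasis, inner_smul_right, mul_assoc, RCLike.re_ofReal_mul,
    inner_mul_symm_re_eq_norm, norm_mul, norm_inner_symm, sq]

theorem exists_forall_le_forall_le {ι : Type*} [Finite ι] {s : Finset ι} {l : ι → ℝ}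
    (h : ∀ i ∈ s, ∀ j ∉ s, l i ≤ l j) : ∃ t, (∀ i ∈ s, l i ≤ t) ∧ ∀ j ∉ s, t ≤ l j := by
  obtain rfl | hs := s.eq_empty_or_nonempty
  · obtain ⟨t, ht⟩ := (Set.finite_range l).bddBelow
    exact ⟨t, by simp, fun j _ => ht ⟨j, rfl⟩⟩
  · exact ⟨s.sup' hs l, fun i hi => Finset.le_sup' l hi,
      fun j hj => Finset.sup'_le hs l fun i hi => h i hi j hj⟩

theorem sum_le_sum_mul_of_forall_le {ι : Type*} [Fintype ι] {s : Finset ι} {l c : ι → ℝ}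
    (hl : ∀ i ∈ s, ∀ j ∉ s, l i ≤ l j) (h0 : ∀ i, 0 ≤ c i) (h1 : ∀ i, c i ≤ 1)
    (hc : ∑ i, c i = s.card) : ∑ i ∈ s, l i ≤ ∑ i, l i * c i := by
  classical
  obtain ⟨t, hs, hsc⟩ := exists_forall_le_forall_le hl
  have key : ∀ i, t * (c i - if i ∈ s then 1 else 0) ≤ l i * c i - if i ∈ s then l i else 0 := by
    intro i
    split_ifs with hi
    · linarith [mul_nonneg (sub_nonneg.2 (hs i hi)) (sub_nonneg.2 (h1 i))]
    · linarith [mul_nonneg (sub_nonneg.2 (hsc i hi)) (h0 i)]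
  have hsum := Finset.sum_le_sum fun i (_ : i ∈ Finset.univ) => key i
  simp only [← Finset.mul_sum, Finset.sum_sub_distrib, Finset.sum_ite_mem, Finset.univ_inter, hc,
    Finset.sum_const, nsmul_eq_mul, mul_one, sub_self, mul_zero] at hsum
  linarith

theorem card_filter_le_val_add {m : ℕ} (hm : m ≤ n) :
    (Finset.univ.filter fun i : Fin n => n ≤ i + m).card = m := by
  obtain ⟨k, rfl⟩ := Nat.exists_eq_add_of_le' hm
  rw [Finset.card_filter, Fin.sum_univ_add]
  simp

/-- Ky Fan's minimum principle. -/
theorem sum_eigenvalues_le_sum_re_inner (hT : T.IsSymmetric) (hn : Module.finrank 𝕜 E = n)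
    {ι : Type*} [Fintype ι] {u : ι → E} (hu : Orthonormal 𝕜 u) :
    ∑ i with n ≤ Fin.val i + Fintype.card ι, hT.eigenvalues hn i ≤
      ∑ j, RCLike.re (inner 𝕜 (T (u j)) (u j)) := by
  have hcard : Fintype.card ι ≤ n := hn ▸ hu.linearIndependent.fintype_card_le_finrank
  simp only [re_inner_map_self_eq_sum_eigenvalues_mul hT hn]
  rw [Finset.sum_comm]
  simp only [← Finset.mul_sum]
  refine sum_le_sum_mul_of_forall_le (fun i hi j hj => hT.eigenvalues_antitone hn ?_)
    (fun i => Finset.sum_nonneg fun _ _ => sq_nonneg _) (fun i => ?_) ?_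
  · simp only [Finset.mem_filter_univ] at hi hj
    exact Fin.le_def.2 (by omega)
  · calc ∑ j, ‖inner 𝕜 (hT.eigenvectorBasis hn i) (u j)‖ ^ 2
        = ∑ j, ‖inner 𝕜 (u j) (hT.eigenvectorBasis hn i)‖ ^ 2 := by simp only [norm_inner_symm]
      _ ≤ ‖hT.eigenvectorBasis hn i‖ ^ 2 := hu.sum_inner_products_le _
      _ = 1 := by simp
  · rw [Finset.sum_comm, card_filter_le_val_add hcard]
    simp [(hT.eigenvectorBasis hn).sum_sq_norm_inner_right, hu.norm_eq_one]

end PositiveOperator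

section Kernel

variable {n : ℕ} {M : Rn n → Rn n → ℂ}

theorem integralOp_congr_ae {f g : Rn n → ℂ} (h : f =ᵐ[volume] g) :
    integralOp M f = integralOp M g := by
  funext x
  refine integral_congr_ae ?_
  filter_upwards [h] with y hy
  rw [hy]

theorem IsKernel.integralOp_add (hM : IsKernel M) {f g : Rn n → ℂ} (hf : MemLp f 2 volume)
    (hg : MemLp g 2 volume) : integralOp M (f + g) = integralOp M f + integralOp M g := by
  funext x
  simp only [integralOp, Pi.add_apply, mul_add]
  exact integral_add (hM.integrable f hf x) (hM.integrable g hg x)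

theorem integralOp_const_smul (c : ℂ) (f : Rn n → ℂ) :
    integralOp M (c • f) = c • integralOp M f := by
  funext x
  simp only [integralOp, Pi.smul_apply, smul_eq_mul, mul_left_comm _ c]
  exact integral_const_mul _ _

/-- The operator `O(M)` on `L²(ℝⁿ)`. -/
noncomputable def IsKernel.operator (hM : IsKernel M) :
    Lp ℂ 2 (volume : Measure (Rn n)) →ₗ[ℂ] Lp ℂ 2 (volume : Measure (Rn n)) where
  toFun f := (hM.memLp f (Lp.memLp f)).toLp
  map_add' f g := by
    rw [← MemLp.toLp_add]
    congr 1
    rw [integralOp_congr_ae (Lp.coeFn_add f g), hM.integralOp_add (Lp.memLp f) (Lp.memLp g)]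
  map_smul' c f := by
    rw [RingHom.id_apply, ← MemLp.toLp_const_smul]
    congr 1
    rw [integralOp_congr_ae (Lp.coeFn_smul c f), integralOp_const_smul]

theorem IsKernel.operator_toLp (hM : IsKernel M) {f : Rn n → ℂ} (hf : MemLp f 2 volume) :
    hM.operator hf.toLp = (hM.memLp f hf).toLp :=
  MemLp.toLp_congr (hM.memLp _ (Lp.memLp _)) _ (.of_eq (integralOp_congr_ae hf.coeFn_toLp))

theorem inner_toLp_toLp {f g : Rn n → ℂ} (hf : MemLp f 2 volume) (hg : MemLp g 2 volume) :
    inner ℂ hf.toLp hg.toLp = ∫ x, conj (f x) * g x := by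
  rw [L2.inner_def]
  refine integral_congr_ae ?_
  filter_upwards [hf.coeFn_toLp, hg.coeFn_toLp] with x hfx hgx
  rw [hfx, hgx, RCLike.inner_apply']

theorem IsKernel.isPositive_operator (hM : IsKernel M) : hM.operator.IsPositive := by
  have hpos : ∀ f, 0 ≤ inner ℂ f (hM.operator f) := by
    intro f
    obtain rfl | hf := eq_or_ne f 0
    · simp
    have h := hM.pos f (Lp.memLp f) (mt Lp.eq_zero_iff_ae_eq_zero.2 hf)
    conv_rhs => rw [← Lp.toLp_coeFn f (Lp.memLp f)]
    rw [hM.operator_toLp, inner_toLp_toLp]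
    exact h.le
  refine (LinearMap.isPositive_iff_complex _).2 fun f => ?_
  have h : 0 ≤ inner ℂ (hM.operator f) f := by
    rw [← inner_conj_symm]
    exact star_nonneg_iff.2 (hpos f)
  rw [Complex.nonneg_iff] at h
  exact ⟨Complex.ext rfl h.2, h.1⟩

end Kernel

section KernelForm

variable {n : ℕ} {M : Rn n → Rn n → ℂ} (hM : IsKernel M) {γ : ℝ} (hγ : ∀ x y, ‖M x y‖ ≤ γ)

include hγ

theorem integrable_kernelForm (hmeas : AEStronglyMeasurable (Function.uncurry M) volume)
    {f g : Rn n → ℂ} (hf : Integrable f) (hg : Integrable g) :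
    Integrable fun z : Rn n × Rn n => conj (f z.1) * M z.1 z.2 * g z.2 := by
  have hf' : Integrable fun x => conj (f x) :=
    Complex.conjLIE.toContinuousLinearEquiv.integrable_comp_iff.2 hf
  refine ((hf'.mul_prod hg).bdd_mul hmeas (Eventually.of_forall fun z => hγ z.1 z.2)).congr
    (Eventually.of_forall fun z => ?_)
  simp only [Function.uncurry]
  ring

theorem norm_kernelForm_le {f g : Rn n → ℂ} (hf : Integrable f) (hg : Integrable g) :
    ‖kernelForm M f g‖ ≤ γ * ((∫ x, ‖f x‖) * ∫ x, ‖g x‖) := by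
  rw [← integral_prod_mul (fun x => ‖f x‖) fun x => ‖g x‖, ← integral_const_mul]
  refine norm_integral_le_of_norm_le ((hf.norm.mul_prod hg.norm).const_mul γ)
    (Eventually.of_forall fun z => ?_)
  rw [norm_mul, norm_mul, RCLike.norm_conj, mul_right_comm, mul_comm γ]
  gcongr
  exact hγ _ _

include hM in
theorem kernelForm_eq_inner (hmeas : AEStronglyMeasurable (Function.uncurry M) volume)
    (f g : 𝓢(Rn n, ℂ)) :
    kernelForm M f g = inner ℂ (f.toLp 2) (hM.operator (g.toLp 2)) := by
  have hg : g.toLp 2 = (g.memLp 2).toLp := rfl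
  have hf : f.toLp 2 = (f.memLp 2).toLp := rfl
  rw [hf, hg, hM.operator_toLp, inner_toLp_toLp, kernelForm, Measure.volume_eq_prod,
    integral_prod _ (integrable_kernelForm hγ hmeas f.integrable g.integrable)]
  simp only [integralOp, mul_assoc, integral_const_mul]

end KernelForm

section AntiNorm

variable {n : ℕ} {A : Matrix (Fin n) (Fin n) ℝ}

theorem antiNorm_eq_sum_eigenvalues (m : ℕ) (hA : A.IsHermitian) :
    antiNorm m hA = ∑ i with Fintype.card (Fin n) ≤ Fin.val i + m,
      (Matrix.isSymmetric_toEuclideanLin_iff.2 hA).eigenvalues finrank_euclideanSpace i := by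
  simp only [antiNorm, Fintype.card_fin, Finset.sum_filter]
  rfl

theorem antiNorm_le_sum_inner (hA : A.IsHermitian) {m : ℕ} {u : Fin m → Rn n}
    (hu : Orthonormal ℝ u) :
    antiNorm m hA ≤ ∑ j, inner ℝ (Matrix.toEuclideanLin A (u j)) (u j) := by
  have h := sum_eigenvalues_le_sum_re_inner (Matrix.isSymmetric_toEuclideanLin_iff.2 hA)
    finrank_euclideanSpace hu
  rwa [Fintype.card_fin m, ← antiNorm_eq_sum_eigenvalues] at h

theorem antiNorm_nonneg (hA : A.PosSemidef) (m : ℕ) : 0 ≤ antiNorm m hA.isHermitian := by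
  rw [antiNorm_eq_sum_eigenvalues]
  exact Finset.sum_nonneg fun i _ =>
    (Matrix.isPositive_toEuclideanLin_iff.2 hA).nonneg_eigenvalues finrank_euclideanSpace i

theorem exists_orthonormalBasis_inner_le_antiNorm (hA : A.PosSemidef) :
    ∃ b : OrthonormalBasis (Fin n) ℝ (Rn n), ∀ (m : ℕ) (i : Fin n), n ≤ i + m →
      inner ℝ (Matrix.toEuclideanLin A (b i)) (b i) ≤ antiNorm m hA.isHermitian := by
  have hT := Matrix.isPositive_toEuclideanLin_iff.2 hA
  let e : Fin (Fintype.card (Fin n)) ≃ Fin n := finCongr (Fintype.card_fin n)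
  refine ⟨(hT.isSymmetric.eigenvectorBasis finrank_euclideanSpace).reindex e, fun m i hi => ?_⟩
  rw [antiNorm_eq_sum_eigenvalues, OrthonormalBasis.reindex_apply, hT.isSymmetric,
    hT.isSymmetric.apply_eigenvectorBasis, inner_smul_right, real_inner_self_eq_norm_sq,
    OrthonormalBasis.norm_eq_one, one_pow, mul_one]
  exact Finset.single_le_sum (f := hT.isSymmetric.eigenvalues finrank_euclideanSpace)
    (fun j _ => hT.nonneg_eigenvalues finrank_euclideanSpace j) (by simpa [e] using hi)

end AntiNorm

section MulLinear

variable {E : Type*} [NormedAddCommGroup E] [NormedSpace ℝ E]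

/-- Multiplication of Schwartz functions by a real linear functional. -/
noncomputable def mulLinear (ℓ : E →L[ℝ] ℝ) : 𝓢(E, ℂ) →L[ℂ] 𝓢(E, ℂ) :=
  SchwartzMap.smulLeftCLM ℂ fun x => (ℓ x : ℂ)

@[simp]
theorem mulLinear_apply (ℓ : E →L[ℝ] ℝ) (f : 𝓢(E, ℂ)) (x : E) : mulLinear ℓ f x = ℓ x * f x := by
  rw [mulLinear, SchwartzMap.smulLeftCLM_apply_apply (by fun_prop), smul_eq_mul]

theorem mulLinear_sum_smul {ι : Type*} (s : Finset ι) (c : ι → ℝ) (ℓ : ι → E →L[ℝ] ℝ)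
    (f : 𝓢(E, ℂ)) :
    mulLinear (∑ i ∈ s, c i • ℓ i) f = ∑ i ∈ s, (c i : ℂ) • mulLinear (ℓ i) f := by
  ext x
  simp [Finset.sum_mul, mul_assoc]

end MulLinear

section Gram

theorem innerSL_eq_sum_smul_proj {n : ℕ} (v : Rn n) :
    innerSL ℝ v = ∑ i, v i • (EuclideanSpace.proj i : Rn n →L[ℝ] ℝ) := by
  ext x
  simp [PiLp.inner_apply, mul_comm]

variable {n : ℕ} {M : Rn n → Rn n → ℂ} (hM : IsKernel M) {γ : ℝ} (hγ : ∀ x y, ‖M x y‖ ≤ γ)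
  (hmeas : AEStronglyMeasurable (Function.uncurry M) volume)

include hM hγ hmeas

theorem inner_toEuclideanLin_gram (f : 𝓢(Rn n, ℂ)) (v : Rn n) :
    inner ℝ (Matrix.toEuclideanLin (gram M f) v) v =
      (kernelForm M (mulLinear (innerSL ℝ v) f) (mulLinear (innerSL ℝ v) f)).re := by
  have hcoord : ∀ i, (fun x : Rn n => (x i : ℂ) * f x) = mulLinear (EuclideanSpace.proj i) f :=
    fun i => by ext x; simp
  have hlin : (mulLinear (innerSL ℝ v) f).toLp 2 =
      ∑ i, (v i : ℂ) • (mulLinear (EuclideanSpace.proj i) f).toLp 2 := by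
    rw [innerSL_eq_sum_smul_proj, mulLinear_sum_smul]
    simpa only [map_smul] using! map_sum (SchwartzMap.toLpCLM ℂ ℂ 2 volume) _ _
  simp only [kernelForm_eq_inner hM hγ hmeas, hlin, map_sum, map_smul, sum_inner, inner_sum,
    inner_smul_left, inner_smul_right, Complex.conj_ofReal, Complex.re_sum, Complex.re_ofReal_mul]
  simp only [PiLp.inner_apply, Matrix.toLpLin_apply, Matrix.mulVec, dotProduct, gram,
    Matrix.of_apply, hcoord, kernelForm_eq_inner hM hγ hmeas, RCLike.inner_apply, conj_trivial,
    Finset.mul_sum]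
  rw [Finset.sum_comm]
  exact Finset.sum_congr rfl fun i _ => Finset.sum_congr rfl fun j _ => by ring

theorem posSemidef_gram (f : 𝓢(Rn n, ℂ)) : (gram M f).PosSemidef := by
  refine Matrix.isPositive_toEuclideanLin_iff.1
    ⟨Matrix.isSymmetric_toEuclideanLin_iff.2 (gram_isHermitian hM f), fun v => ?_⟩
  rw [RCLike.re_to_real, inner_toEuclideanLin_gram hM hγ hmeas, kernelForm_eq_inner hM hγ hmeas]
  exact hM.isPositive_operator.re_inner_nonneg_right _

end Gram

section Tensor

variable {E₁ E₂ : Type*} [NormedAddCommGroup E₁] [NormedSpace ℝ E₁] [NormedAddCommGroup E₂]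
  [NormedSpace ℝ E₂]

theorem norm_iteratedFDeriv_comp_clm_le {D F : Type*} [NormedAddCommGroup D] [NormedSpace ℝ D]
    [NormedAddCommGroup F] [NormedSpace ℝ F] {n : WithTop ℕ∞} {f : E₁ → F} (hf : ContDiff ℝ n f)
    (P : D →L[ℝ] E₁) (hP : ‖P‖ ≤ 1) {i : ℕ} (hi : i ≤ n) (x : D) :
    ‖iteratedFDeriv ℝ i (fun x => f (P x)) x‖ ≤ ‖iteratedFDeriv ℝ i f (P x)‖ := by
  change ‖iteratedFDeriv ℝ i (f ∘ P) x‖ ≤ _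
  rw [P.iteratedFDeriv_comp_right hf x hi]
  refine (ContinuousMultilinearMap.norm_compContinuousLinearMap_le _ _).trans ?_
  simpa using mul_le_of_le_one_right (norm_nonneg _) (pow_le_one₀ (norm_nonneg P) hP)

theorem norm_pow_mul_norm_iteratedFDeriv_tensor_le (f : 𝓢(E₁, ℂ)) (g : 𝓢(E₂, ℂ)) (K N : ℕ)
    (z : E₁ × E₂) :
    ‖z‖ ^ K * ‖iteratedFDeriv ℝ N (fun z : E₁ × E₂ => f z.1 * g z.2) z‖ ≤
      ∑ i ∈ Finset.range (N + 1), N.choose i *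
        ((1 + ‖z.1‖) ^ K * ‖iteratedFDeriv ℝ i f z.1‖) *
        ((1 + ‖z.2‖) ^ K * ‖iteratedFDeriv ℝ (N - i) g z.2‖) := by
  have hz : ‖z‖ ≤ (1 + ‖z.1‖) * (1 + ‖z.2‖) := by
    rw [Prod.norm_def]
    apply max_le <;> nlinarith [norm_nonneg z.1, norm_nonneg z.2,
      mul_nonneg (norm_nonneg z.1) (norm_nonneg z.2)]
  have hleibniz := norm_iteratedFDeriv_mul_le (n := N) ((f.smooth N).comp contDiff_fst)
    ((g.smooth N).comp contDiff_snd) z le_rfl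
  refine (mul_le_mul (pow_le_pow_left₀ (norm_nonneg z) hz K) hleibniz (norm_nonneg _)
    (by positivity)).trans ?_
  rw [Finset.mul_sum]
  refine Finset.sum_le_sum fun i _ => ?_
  have hf := norm_iteratedFDeriv_comp_clm_le (f.smooth i) (.fst ℝ E₁ E₂)
    (ContinuousLinearMap.norm_fst_le ..) le_rfl z
  have hg := norm_iteratedFDeriv_comp_clm_le (g.smooth (N - i : ℕ)) (.snd ℝ E₁ E₂)
    (ContinuousLinearMap.norm_snd_le ..) le_rfl z
  calc ((1 + ‖z.1‖) * (1 + ‖z.2‖)) ^ K * (N.choose i *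
        ‖iteratedFDeriv ℝ i (fun z : E₁ × E₂ => f z.1) z‖ *
        ‖iteratedFDeriv ℝ (N - i) (fun z : E₁ × E₂ => g z.2) z‖)
      ≤ ((1 + ‖z.1‖) * (1 + ‖z.2‖)) ^ K * (N.choose i *
        ‖iteratedFDeriv ℝ i f z.1‖ * ‖iteratedFDeriv ℝ (N - i) g z.2‖) := by
        gcongr
        exacts [hf, hg]
    _ = _ := by rw [mul_pow]; ring

/-- The tensor product `f ⊗ g : (x, y) ↦ f x * g y` of Schwartz functions, as a continuous linear
map of `f`. -/
noncomputable def tensor (g : 𝓢(E₂, ℂ)) : 𝓢(E₁, ℂ) →L[ℂ] 𝓢(E₁ × E₂, ℂ) :=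
  SchwartzMap.mkCLM (fun f z => f z.1 * g z.2)
    (fun f₁ f₂ z => by simp [add_mul])
    (fun a f z => by simp [mul_assoc])
    (fun f => ((f.smooth ⊤).comp contDiff_fst).mul ((g.smooth ⊤).comp contDiff_snd))
    (by
      rintro ⟨K, N⟩
      refine ⟨Finset.Iic (K, N), ∑ i ∈ Finset.range (N + 1), N.choose i * 2 ^ K *
        (2 ^ K * (Finset.Iic (K, N)).sup (fun m => SchwartzMap.seminorm ℂ m.1 m.2) g),
        by positivity, fun f z => ?_⟩
      refine (norm_pow_mul_norm_iteratedFDeriv_tensor_le f g K N z).trans ?_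
      rw [Finset.sum_mul]
      refine Finset.sum_le_sum fun i hi => ?_
      have hf := SchwartzMap.one_add_le_sup_seminorm_apply (𝕜 := ℂ) (m := (K, N)) le_rfl
        (Finset.mem_range_succ_iff.1 hi) f z.1
      have hg := SchwartzMap.one_add_le_sup_seminorm_apply (𝕜 := ℂ) (m := (K, N)) le_rfl
        (Nat.sub_le N i) g z.2
      refine (mul_le_mul (mul_le_mul_of_nonneg_left hf (by positivity)) hg (by positivity)
        (by positivity)).trans_eq ?_
      change _ = _ * (Finset.Iic (K, N)).sup (fun m => SchwartzMap.seminorm ℂ m.1 m.2) f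
      ring)

@[simp]
theorem tensor_apply (f : 𝓢(E₁, ℂ)) (g : 𝓢(E₂, ℂ)) (z : E₁ × E₂) :
    tensor g f z = f z.1 * g z.2 := rfl

end Tensor

section FiberIntegral

universe u

variable {V : Type*} {E F : Type u} [NormedAddCommGroup V] [NormedSpace ℝ V]
  [NormedAddCommGroup E] [NormedSpace ℝ E] [NormedAddCommGroup F] [NormedSpace ℝ F]

/-- The partial Fréchet derivative, with respect to the first variable, of a Schwartz function on
a product. -/
noncomputable def fderivFst (H : 𝓢(E × V, F)) : 𝓢(E × V, E →L[ℝ] F) :=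
  SchwartzMap.postcompCLM ((ContinuousLinearMap.compL ℝ E (E × V) F).flip (.inl ℝ E V))
    (SchwartzMap.fderivCLM ℝ (E × V) F H)

theorem hasFDerivAt_fderivFst (H : 𝓢(E × V, F)) (x : E) (t : V) :
    HasFDerivAt (fun x => H (x, t)) (fderivFst H (x, t)) x :=
  (H.hasFDerivAt (x, t)).comp x (hasFDerivAt_prodMk_left x t)

variable [MeasurableSpace V] [BorelSpace V] [SecondCountableTopology V] (μ : Measure V)
  [IsFiniteMeasure μ]

theorem integrable_fiber (H : 𝓢(E × V, F)) (x : E) : Integrable (fun t => H (x, t)) μ :=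
  .of_bound (H.continuous.comp (by fun_prop)).aestronglyMeasurable (SchwartzMap.seminorm ℝ 0 0 H)
    (.of_forall fun _ => SchwartzMap.norm_le_seminorm ℝ H _)

theorem hasFDerivAt_integral_fiber (H : 𝓢(E × V, F)) (x : E) :
    HasFDerivAt (fun x => ∫ t, H (x, t) ∂μ) (∫ t, fderivFst H (x, t) ∂μ) x :=
  hasFDerivAt_integral_of_dominated_of_fderiv_le (F' := fun x t => fderivFst H (x, t)) univ_mem
    (.of_forall fun x => (integrable_fiber μ H x).aestronglyMeasurable) (integrable_fiber μ H x)
    (integrable_fiber μ (fderivFst H) x).aestronglyMeasurable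
    (.of_forall fun _ _ _ => SchwartzMap.norm_le_seminorm ℝ (fderivFst H) _)
    (integrable_const _) (.of_forall fun t x _ => hasFDerivAt_fderivFst H x t)

theorem contDiff_integral_fiber (n : ℕ) (H : 𝓢(E × V, F)) :
    ContDiff ℝ n fun x => ∫ t, H (x, t) ∂μ := by
  induction n generalizing F with
  | zero =>
    exact contDiff_zero.2 (Differentiable.continuous (𝕜 := ℝ)
      fun x => (hasFDerivAt_integral_fiber μ H x).differentiableAt)
  | succ n ih =>
    exact contDiff_succ_iff_hasFDerivAt.2
      ⟨fun x => ∫ t, fderivFst H (x, t) ∂μ, ih (fderivFst H), hasFDerivAt_integral_fiber μ H⟩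

theorem exists_norm_pow_mul_iteratedFDeriv_integral_fiber_le (k n : ℕ) (H : 𝓢(E × V, F)) :
    ∃ C, ∀ x, ‖x‖ ^ k * ‖iteratedFDeriv ℝ n (fun x => ∫ t, H (x, t) ∂μ) x‖ ≤ C := by
  induction n generalizing F with
  | zero =>
    refine ⟨SchwartzMap.seminorm ℝ k 0 H * μ.real Set.univ, fun x => ?_⟩
    rw [norm_iteratedFDeriv_zero, ← norm_norm x, ← norm_pow, ← norm_smul, ← integral_smul]
    refine norm_integral_le_of_norm_le_const (.of_forall fun t => ?_)
    rw [norm_smul, norm_pow, norm_norm]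
    calc ‖x‖ ^ k * ‖H (x, t)‖ ≤ ‖(x, t)‖ ^ k * ‖H (x, t)‖ := by
          gcongr
          exact norm_fst_le (x, t)
      _ ≤ _ := SchwartzMap.norm_pow_mul_le_seminorm ℝ H k (x, t)
  | succ n ih =>
    obtain ⟨C, hC⟩ := ih (fderivFst H)
    have hfderiv : fderiv ℝ (fun x => ∫ t, H (x, t) ∂μ) = fun x => ∫ t, fderivFst H (x, t) ∂μ :=
      funext fun x => (hasFDerivAt_integral_fiber μ H x).fderiv
    exact ⟨C, fun x => by rw [← norm_iteratedFDeriv_fderiv, hfderiv]; exact hC x⟩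

/-- The Schwartz function `x ↦ ∫ H (x, t) dμ(t)` obtained by integrating a Schwartz function on a
product along the fibres of the first projection. -/
noncomputable def fiberIntegral (H : 𝓢(E × V, F)) : 𝓢(E, F) where
  toFun x := ∫ t, H (x, t) ∂μ
  smooth' := contDiff_infty.2 fun n => contDiff_integral_fiber μ n H
  decay' k n := exists_norm_pow_mul_iteratedFDeriv_integral_fiber_le μ k n H

@[simp]
theorem fiberIntegral_apply (H : 𝓢(E × V, F)) (x : E) :
    fiberIntegral μ H x = ∫ t, H (x, t) ∂μ := rfl

end FiberIntegral

theorem hasTemperateGrowth_prodMk {D E F : Type*} [NormedAddCommGroup D] [NormedSpace ℝ D]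
    [NormedAddCommGroup E] [NormedSpace ℝ E] [NormedAddCommGroup F] [NormedSpace ℝ F] {f : D → E}
    {g : D → F} (hf : f.HasTemperateGrowth) (hg : g.HasTemperateGrowth) :
    (fun x => (f x, g x)).HasTemperateGrowth := by
  have h : (fun x => ContinuousLinearMap.inl ℝ E F (f x) + ContinuousLinearMap.inr ℝ E F (g x)) =
      fun x => (f x, g x) := by
    ext x <;> simp
  rw [← h]
  fun_prop

section Bump

variable (V : Type*) [NormedAddCommGroup V] [NormedSpace ℝ V] [HasContDiffBump V]
  [FiniteDimensional ℝ V]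

/-- A nonnegative compactly supported Schwartz function which is `1` on the unit ball. -/
noncomputable def bump : 𝓢(V, ℂ) :=
  let b : ContDiffBump (0 : V) := ⟨1, 2, one_pos, one_lt_two⟩
  (b.hasCompactSupport.comp_left Complex.ofReal_zero).toSchwartzMap
    (Complex.ofRealCLM.contDiff.comp b.contDiff)

variable {V} in
theorem bump_apply_of_norm_le_one {x : V} (hx : ‖x‖ ≤ 1) : bump V x = 1 := by
  let b : ContDiffBump (0 : V) := ⟨1, 2, one_pos, one_lt_two⟩
  change ((b x : ℝ) : ℂ) = 1
  rw [b.one_of_mem_closedBall (by simpa using hx), Complex.ofReal_one]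

theorem bump_apply_zero : bump V 0 = 1 :=
  bump_apply_of_norm_le_one (by simp)

theorem integral_bump_ne_zero [MeasureSpace V] [BorelSpace V]
    [(volume : Measure V).IsAddHaarMeasure] : ∫ x, bump V x ≠ 0 := by
  let b : ContDiffBump (0 : V) := ⟨1, 2, one_pos, one_lt_two⟩
  change ∫ x, ((b x : ℝ) : ℂ) ≠ 0
  rw [integral_complex_ofReal, Complex.ofReal_ne_zero]
  exact b.integral_pos.ne'

end Bump

section Restriction

open LineDeriv

variable {E V : Type*} [NormedAddCommGroup E] [NormedAddCommGroup V] [NormedSpace ℝ V]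

/-- The map `((x, y), t) ↦ (((x, t • y), (1 - t) • y), t)`, which turns `(φ ⊗ Γ) ⊗ θ` into a
homotopy from `φ (·, 0) ⊗ Γ` to `φ`. -/
def splitSnd (p : (E × V) × ℝ) : ((E × V) × V) × ℝ :=
  (((p.1.1, p.2 • p.1.2), (1 - p.2) • p.1.2), p.2)

theorem norm_le_two_mul_norm_splitSnd (p : (E × V) × ℝ) : ‖p‖ ≤ 2 * ‖splitSnd p‖ := by
  obtain ⟨⟨x, y⟩, t⟩ := p
  have hy : ‖y‖ ≤ ‖t • y‖ + ‖(1 - t) • y‖ := by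
    simpa only [← add_smul, add_sub_cancel, one_smul] using norm_add_le (t • y) ((1 - t) • y)
  simp only [splitSnd, Prod.norm_mk]
  grind [norm_nonneg]

variable [NormedSpace ℝ E]

theorem hasTemperateGrowth_splitSnd :
    (splitSnd : (E × V) × ℝ → ((E × V) × V) × ℝ).HasTemperateGrowth := by
  have hx : Function.HasTemperateGrowth fun p : (E × V) × ℝ => p.1.1 :=
    (ContinuousLinearMap.fst ℝ E V ∘L ContinuousLinearMap.fst ℝ (E × V) ℝ).hasTemperateGrowth
  have hy : Function.HasTemperateGrowth fun p : (E × V) × ℝ => p.1.2 :=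
    (ContinuousLinearMap.snd ℝ E V ∘L ContinuousLinearMap.fst ℝ (E × V) ℝ).hasTemperateGrowth
  have ht : Function.HasTemperateGrowth fun p : (E × V) × ℝ => p.2 :=
    (ContinuousLinearMap.snd ℝ (E × V) ℝ).hasTemperateGrowth
  exact hasTemperateGrowth_prodMk (hasTemperateGrowth_prodMk
    (hasTemperateGrowth_prodMk hx (by fun_prop)) (by fun_prop)) ht

/-- The Schwartz function `((x, y), t) ↦ φ (x, t • y) * Γ ((1 - t) • y) * θ t`. -/
noncomputable def homotopy (φ : 𝓢(E × V, ℂ)) (Γ : 𝓢(V, ℂ)) (θ : 𝓢(ℝ, ℂ)) :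
    𝓢((E × V) × ℝ, ℂ) :=
  SchwartzMap.compCLM ℂ hasTemperateGrowth_splitSnd
    ⟨1, 2, fun p => by linarith [norm_le_two_mul_norm_splitSnd p]⟩ (tensor θ (tensor Γ φ))

theorem homotopy_apply (φ : 𝓢(E × V, ℂ)) (Γ : 𝓢(V, ℂ)) (θ : 𝓢(ℝ, ℂ)) (x : E) (y : V) (t : ℝ) :
    homotopy φ Γ θ ((x, y), t) = φ (x, t • y) * Γ ((1 - t) • y) * θ t := rfl

/-- The restriction `φ ↦ φ (·, 0)` to the first factor of Schwartz functions on a product. -/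
noncomputable def restrictFst : 𝓢(E × V, ℂ) →L[ℂ] 𝓢(E, ℂ) :=
  SchwartzMap.compCLMOfAntilipschitz ℂ (ContinuousLinearMap.inl ℝ E V).hasTemperateGrowth
    (LinearIsometry.inl ℝ E V).isometry.antilipschitz

@[simp]
theorem restrictFst_apply (φ : 𝓢(E × V, ℂ)) (x : E) : restrictFst φ x = φ (x, 0) := rfl

theorem hasDerivAt_mul_comp_smul (φ : 𝓢(E × V, ℂ)) (Γ : 𝓢(V, ℂ)) (x : E) (y : V) (t : ℝ) :
    HasDerivAt (fun t : ℝ => φ (x, t • y) * Γ ((1 - t) • y))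
      (∂_{((0 : E), y)} φ (x, t • y) * Γ ((1 - t) • y) -
        φ (x, t • y) * ∂_{y} Γ ((1 - t) • y)) t := by
  have hφ : HasDerivAt (fun t : ℝ => φ (x, t • y)) (∂_{((0 : E), y)} φ (x, t • y)) t := by
    rw [SchwartzMap.lineDerivOp_apply_eq_fderiv]
    refine (φ.hasFDerivAt (x, t • y)).comp_hasDerivAt t ((hasDerivAt_const t x).prodMk ?_)
    simpa only [id, one_smul] using (hasDerivAt_id t).smul_const y
  have hΓ : HasDerivAt (fun t : ℝ => Γ ((1 - t) • y)) (-∂_{y} Γ ((1 - t) • y)) t := by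
    rw [SchwartzMap.lineDerivOp_apply_eq_fderiv, ← map_neg, ← neg_one_smul ℝ y]
    exact (Γ.hasFDerivAt ((1 - t) • y)).comp_hasDerivAt t
      (((hasDerivAt_id t).const_sub 1).smul_const y)
  rw [sub_eq_add_neg, ← mul_neg]
  exact hφ.mul hΓ

theorem lineDerivOp_sum_smul_apply {ι D : Type*} [NormedAddCommGroup D] [NormedSpace ℝ D]
    (s : Finset ι) (c : ι → ℝ) (v : ι → D) (f : 𝓢(D, ℂ)) (z : D) :
    ∂_{∑ j ∈ s, c j • v j} f z = ∑ j ∈ s, (c j : ℂ) * ∂_{v j} f z := by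
  simp [SchwartzMap.lineDerivOp_apply_eq_fderiv]

end Restriction

section Division

open LineDeriv

-- The smoothness of `fiberIntegral` forces `E × V` and `ℂ` into the same universe.
variable {E V : Type} [NormedAddCommGroup E] [NormedSpace ℝ E] [NormedAddCommGroup V]
  [NormedSpace ℝ V]

theorem exists_sub_tensor_restrictFst_eq_sum_mulLinear {ι : Type*} [Fintype ι] {e : ι → V}
    {ℓ : ι → V →L[ℝ] ℝ} (hℓ : ∀ y, ∑ j, ℓ j y • e j = y) {Γ : 𝓢(V, ℂ)} (hΓ : Γ 0 = 1)
    (φ : 𝓢(E × V, ℂ)) :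
    ∃ h : ι → 𝓢(E × V, ℂ),
      φ - tensor Γ (restrictFst φ) = ∑ j, mulLinear (ℓ j ∘L .snd ℝ E V) (h j) := by
  let H (j : ι) : 𝓢((E × V) × ℝ, ℂ) :=
    homotopy (∂_{((0 : E), e j)} φ) Γ (bump ℝ) - homotopy φ (∂_{e j} Γ) (bump ℝ)
  have hderiv (x : E) (y : V) (t : ℝ) (ht : t ∈ Set.Icc (0 : ℝ) 1) :
      HasDerivAt (fun t : ℝ => φ (x, t • y) * Γ ((1 - t) • y))
        (∑ j, (ℓ j y : ℂ) * H j ((x, y), t)) t := by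
    have hbump : bump ℝ t = 1 :=
      bump_apply_of_norm_le_one (by simpa [abs_of_nonneg ht.1] using ht.2)
    have hy : ∑ j, ℓ j y • ((0 : E), e j) = (0, y) := by
      simp [Prod.ext_iff, Prod.fst_sum, Prod.snd_sum, hℓ]
    convert hasDerivAt_mul_comp_smul φ Γ x y t using 1
    calc ∑ j, (ℓ j y : ℂ) * H j ((x, y), t)
        = (∑ j, (ℓ j y : ℂ) * ∂_{((0 : E), e j)} φ (x, t • y)) * Γ ((1 - t) • y) -
          φ (x, t • y) * ∑ j, (ℓ j y : ℂ) * ∂_{e j} Γ ((1 - t) • y) := by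
          simp only [H, sub_apply, homotopy_apply, hbump, mul_one, Finset.sum_mul,
            Finset.mul_sum, ← Finset.sum_sub_distrib]
          exact Finset.sum_congr rfl fun j _ => by ring
      _ = _ := by rw [← lineDerivOp_sum_smul_apply, ← lineDerivOp_sum_smul_apply, hℓ, hy]
  refine ⟨fun j => fiberIntegral (volume.restrict (Set.Ioc (0 : ℝ) 1)) (H j), ?_⟩
  ext ⟨x, y⟩
  have hftc := intervalIntegral.integral_eq_sub_of_hasDerivAt (a := 0) (b := 1)
    (fun t ht => hderiv x y t (by simpa using ht))
    (Continuous.intervalIntegrable (by fun_prop) _ _)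
  rw [intervalIntegral.integral_finsetSum fun j _ =>
    Continuous.intervalIntegrable (by fun_prop) _ _] at hftc
  simpa [intervalIntegral.integral_of_le, integral_const_mul, hΓ] using hftc.symm

theorem apply_eq_apply_tensor_restrictFst {ι : Type*} [Fintype ι] {e : ι → V}
    {ℓ : ι → V →L[ℝ] ℝ} (hℓ : ∀ y, ∑ j, ℓ j y • e j = y) {Γ : 𝓢(V, ℂ)} (hΓ : Γ 0 = 1)
    {S : 𝓢'(E × V, ℂ)} (hS : ∀ j ψ, S (mulLinear (ℓ j ∘L .snd ℝ E V) ψ) = 0) (φ : 𝓢(E × V, ℂ)) :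
    S φ = S (tensor Γ (restrictFst φ)) := by
  obtain ⟨h, hh⟩ := exists_sub_tensor_restrictFst_eq_sum_mulLinear hℓ hΓ φ
  rw [← sub_eq_zero, ← map_sub, hh, map_sum]
  exact Finset.sum_eq_zero fun j _ => hS j (h j)

end Division

section Squeeze

variable {E V : Type*} [NormedAddCommGroup E] [NormedSpace ℝ E] [NormedAddCommGroup V]
  [NormedSpace ℝ V]

/-- The Schwartz function `(x, y) ↦ |s| ^ dim V * F (x, s • y)`, which concentrates on
`E × {0}` as `s → ∞`. -/
noncomputable def squeeze (s : ℝˣ) (F : 𝓢(E × V, ℂ)) : 𝓢(E × V, ℂ) :=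
  |(s : ℝ)| ^ Module.finrank ℝ V • SchwartzMap.compCLMOfContinuousLinearEquiv ℂ
    ((ContinuousLinearEquiv.refl ℝ E).prodCongr (.smulLeft s)) F

theorem squeeze_apply (s : ℝˣ) (F : 𝓢(E × V, ℂ)) (z : E × V) :
    squeeze s F z = |(s : ℝ)| ^ Module.finrank ℝ V • F (z.1, (s : ℝ) • z.2) := rfl

variable [FiniteDimensional ℝ V] [MeasureSpace V] [BorelSpace V]
  [(volume : Measure V).IsAddHaarMeasure]

theorem integral_comp_smul_snd {X G : Type*} [MeasureSpace X] [SFinite (volume : Measure X)]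
    [NormedAddCommGroup G] [NormedSpace ℝ G] (s : ℝˣ) (g : X × V → G) :
    ∫ z : X × V, |(s : ℝ)| ^ Module.finrank ℝ V • g (z.1, (s : ℝ) • z.2) = ∫ z, g z := by
  let e : X × V ≃ᵐ X × V := (MeasurableEquiv.refl X).prodCongr (.smul₀ (s : ℝ) s.ne_zero)
  have hmap : volume.map e =
      ENNReal.ofReal |((s : ℝ) ^ Module.finrank ℝ V)⁻¹| • (volume : Measure (X × V)) := by
    change (volume.prod volume).map (Prod.map id ((s : ℝ) • ·)) = _
    rw [← Measure.map_prod_map _ _ measurable_id (measurable_const_smul _), Measure.map_id,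
      Measure.map_addHaar_smul _ s.ne_zero, Measure.prod_smul_right]
    rfl
  have h := integral_map_equiv (μ := volume) e g
  rw [hmap, integral_smul_measure, ENNReal.toReal_ofReal (abs_nonneg _)] at h
  rw [integral_smul]
  change _ • ∫ z, g (e z) = _
  rw [← h, smul_smul, abs_inv, abs_pow, mul_inv_cancel₀ (by simp), one_smul]

variable [MeasureSpace E] [SFinite (volume : Measure E)]

theorem integral_mul_squeeze (s : ℝˣ) (F : 𝓢(E × V, ℂ)) (φ : E × V → ℂ) :
    ∫ z, φ z * squeeze s F z = ∫ z, φ (z.1, (s : ℝ)⁻¹ • z.2) * F z := by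
  rw [← integral_comp_smul_snd s fun z => φ (z.1, (s : ℝ)⁻¹ • z.2) * F z]
  simp only [squeeze_apply, mul_smul_comm, inv_smul_smul₀ s.ne_zero]

theorem integral_norm_mulLinear_squeeze (s : ℝˣ) (F : 𝓢(E × V, ℂ)) (ℓ : V →L[ℝ] ℝ) :
    ∫ z, ‖mulLinear (ℓ ∘L .snd ℝ E V) (squeeze s F) z‖ =
      |(s : ℝ)|⁻¹ * ∫ z, ‖mulLinear (ℓ ∘L .snd ℝ E V) F z‖ := by
  rw [← integral_comp_smul_snd s fun z => ‖mulLinear (ℓ ∘L .snd ℝ E V) F z‖,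
    ← integral_const_mul]
  refine integral_congr_ae (.of_forall fun z => ?_)
  have hs : |(s : ℝ)| ≠ 0 := by simp
  simp only [squeeze_apply, mulLinear_apply, ContinuousLinearMap.comp_apply,
    ContinuousLinearMap.coe_snd', map_smul, smul_eq_mul, norm_mul, norm_smul, Complex.norm_real,
    Real.norm_eq_abs, abs_pow, abs_abs]
  field_simp

variable [FiniteDimensional ℝ E] [BorelSpace E] [(volume : Measure E).IsAddHaarMeasure]

theorem tendsto_integral_mul_squeeze {ι : Type*} {l : Filter ι} [l.IsCountablyGenerated]
    {s : ι → ℝˣ} (hs : Tendsto (fun i => (s i : ℝ)⁻¹) l (𝓝 0)) (φ F : 𝓢(E × V, ℂ)) :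
    Tendsto (fun i => ∫ z, φ z * squeeze (s i) F z) l (𝓝 (∫ z : E × V, φ (z.1, 0) * F z)) := by
  have : (volume : Measure (E × V)).IsAddHaarMeasure :=
    inferInstanceAs (Measure.prod volume volume).IsAddHaarMeasure
  simp only [integral_mul_squeeze]
  refine tendsto_integral_filter_of_dominated_convergence
    (fun z => SchwartzMap.seminorm ℝ 0 0 φ * ‖F z‖) (.of_forall fun i => ?_)
    (.of_forall fun i => .of_forall fun z => ?_) (F.integrable.norm.const_mul _)
    (.of_forall fun z => ?_)
  · exact Continuous.aestronglyMeasurable (by fun_prop)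
  · rw [norm_mul]
    gcongr
    exact φ.norm_le_seminorm ℝ _
  · have h : Tendsto (fun i => (z.1, (s i : ℝ)⁻¹ • z.2)) l (𝓝 (z.1, 0)) := by
      simpa using tendsto_const_nhds.prodMk_nhds (hs.smul_const z.2)
    exact ((φ.continuous.tendsto _).comp h).mul_const _

theorem tendsto_integral_mul_squeeze_tensor {ι : Type*} {l : Filter ι} [l.IsCountablyGenerated]
    {s : ι → ℝˣ} (hs : Tendsto (fun i => (s i : ℝ)⁻¹) l (𝓝 0)) {Γ : 𝓢(V, ℂ)}
    (hΓ : ∫ y, Γ y = 1) (f : 𝓢(E, ℂ)) (φ : 𝓢(E × V, ℂ)) :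
    Tendsto (fun i => ∫ z, φ z * squeeze (s i) (tensor Γ f) z) l (𝓝 (∫ x, φ (x, 0) * f x)) := by
  convert tendsto_integral_mul_squeeze hs φ (tensor Γ f) using 2
  have h := integral_prod_mul (μ := (volume : Measure E)) (ν := (volume : Measure V))
    (fun x => φ (x, 0) * f x) Γ
  rw [hΓ, mul_one] at h
  simp only [tensor_apply, ← mul_assoc]
  exact h.symm

end Squeeze

section Coordinates

variable {k m : ℕ} (U : Rn (k + m) ≃ₗᵢ[ℝ] Rn (k + m))

/-- The splitting of `U x` into its first `k` and its last `m` coordinates; it carries the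
distributions of `G'` attached to `U` to distributions on `ℝᵏ × {0}`. -/
noncomputable def coords : Rn (k + m) ≃L[ℝ] Rn k × Rn m :=
  U.toContinuousLinearEquiv.trans EuclideanSpace.finAddEquivProd

theorem coords_snd_apply (x : Rn (k + m)) (j : Fin m) : (coords U x).2 j = U x (Fin.natAdd k j) :=
  rfl

theorem coords_symm_mk_zero (x : Rn k) :
    (coords U).symm (x, 0) = U.symm (padZero (Nat.le_add_right k m) x) := by
  rw [ContinuousLinearEquiv.symm_apply_eq]
  refine Prod.ext ?_ ?_ <;> ext i <;>
    simp [coords, padZero]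

theorem measurePreserving_coords : MeasurePreserving (coords U) :=
  (WithLp.volume_preserving_ofLp (Rn k) (Rn m)).comp
    ((U.trans (.piLpCongrLeft 2 ℝ ℝ finSumFinEquiv.symm)).trans
      (PiLp.sumPiLpEquivProdLpPiLp 2 fun _ => ℝ)).measurePreserving

theorem integral_comp_coords {G : Type*} [NormedAddCommGroup G] [NormedSpace ℝ G]
    (g : Rn k × Rn m → G) : ∫ x, g (coords U x) = ∫ z, g z :=
  (measurePreserving_coords U).integral_comp
    (coords U).toHomeomorph.measurableEmbedding g

theorem regular_apply {n : ℕ} (f φ : 𝓢(Rn n, ℂ)) : regular f φ = ∫ x, φ x * f x := by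
  simp [regular]

theorem regular_comp_coords_apply (F : 𝓢(Rn k × Rn m, ℂ)) (φ : 𝓢(Rn (k + m), ℂ)) :
    regular (SchwartzMap.compCLMOfContinuousLinearEquiv ℂ (coords U) F) φ =
      ∫ z, SchwartzMap.compCLMOfContinuousLinearEquiv ℂ (coords U).symm φ z * F z := by
  rw [regular_apply, ← integral_comp_coords U]
  simp

theorem rotate_tensorDelta_apply (g : 𝓢'(Rn k, ℂ)) (φ : 𝓢(Rn (k + m), ℂ)) :
    rotate U (tensorDelta (Nat.le_add_right k m) g) φ =
      g (restrictFst (SchwartzMap.compCLMOfContinuousLinearEquiv ℂ (coords U).symm φ)) := by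
  change g _ = g _
  congr 1
  ext x
  exact congrArg φ (coords_symm_mk_zero U x).symm

/-- The unit vector of `ℝᵏ⁺ᵐ` along the `j`-th of the last `m` coordinates of `coords U`. -/
noncomputable def normal (j : Fin m) : Rn (k + m) :=
  U.symm (EuclideanSpace.single (Fin.natAdd k j) 1)

theorem orthonormal_normal : Orthonormal ℝ (normal U) := by
  simpa [Function.comp_def, normal] using!
    ((EuclideanSpace.basisFun (Fin (k + m)) ℝ).map U.symm).orthonormal.comp _
      (Fin.natAdd_injective m k)

theorem inner_normal (j : Fin m) (x : Rn (k + m)) : inner ℝ (normal U j) x = (coords U x).2 j := by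
  rw [normal, ← U.inner_map_map, U.apply_symm_apply, EuclideanSpace.inner_single_left, map_one,
    one_mul, coords_snd_apply]

theorem mulLinear_normal_comp_coords (j : Fin m) (F : 𝓢(Rn k × Rn m, ℂ)) :
    mulLinear (innerSL ℝ (normal U j))
        (SchwartzMap.compCLMOfContinuousLinearEquiv ℂ (coords U) F) =
      SchwartzMap.compCLMOfContinuousLinearEquiv ℂ (coords U)
        (mulLinear (EuclideanSpace.proj j ∘L .snd ℝ (Rn k) (Rn m)) F) := by
  ext x
  simp [inner_normal]

end Coordinates

section Approximation

theorem R_nonneg {n : ℕ} (k : ℕ) {M : Rn n → Rn n → ℂ} {γ : ℝ} (hM : IsKernel M)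
    (hγ : ∀ x y, ‖M x y‖ ≤ γ) (hmeas : AEStronglyMeasurable (Function.uncurry M) volume)
    (f : 𝓢(Rn n, ℂ)) : 0 ≤ R k hM f :=
  antiNorm_nonneg (posSemidef_gram hM hγ hmeas f) _

variable {k m : ℕ} (U : Rn (k + m) ≃ₗᵢ[ℝ] Rn (k + m)) {M : Rn (k + m) → Rn (k + m) → ℂ}

theorem R_comp_coords_squeeze_le {γ : ℝ} (hM : IsKernel M)
    (hγ : ∀ x y, ‖M x y‖ ≤ γ) (hmeas : AEStronglyMeasurable (Function.uncurry M) volume)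
    (s : ℝˣ) (F : 𝓢(Rn k × Rn m, ℂ)) :
    R k hM (SchwartzMap.compCLMOfContinuousLinearEquiv ℂ (coords U) (squeeze s F)) ≤
      ∑ j : Fin m, γ * (|(s : ℝ)|⁻¹ *
        ∫ z, ‖mulLinear (EuclideanSpace.proj j ∘L .snd ℝ (Rn k) (Rn m)) F z‖) ^ 2 := by
  have hR := antiNorm_le_sum_inner (gram_isHermitian hM
    (SchwartzMap.compCLMOfContinuousLinearEquiv ℂ (coords U) (squeeze s F))) (orthonormal_normal U)
  rw [R, Nat.add_sub_cancel_left]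
  refine hR.trans (Finset.sum_le_sum fun j _ => ?_)
  rw [inner_toEuclideanLin_gram hM hγ hmeas, mulLinear_normal_comp_coords]
  refine (Complex.re_le_norm _).trans ((norm_kernelForm_le hγ (SchwartzMap.integrable _)
    (SchwartzMap.integrable _)).trans_eq ?_)
  simp only [SchwartzMap.compCLMOfContinuousLinearEquiv_apply, Function.comp_apply]
  rw [integral_comp_coords U fun z =>
    ‖mulLinear (EuclideanSpace.proj j ∘L .snd ℝ (Rn k) (Rn m)) (squeeze s F) z‖,
    integral_norm_mulLinear_squeeze, sq]

theorem tendsto_R_comp_coords_squeeze {γ : ℝ} (hM : IsKernel M)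
    (hγ : ∀ x y, ‖M x y‖ ≤ γ) (hmeas : AEStronglyMeasurable (Function.uncurry M) volume)
    {ι : Type*} {l : Filter ι} {s : ι → ℝˣ} (hs : Tendsto (fun i => (s i : ℝ)⁻¹) l (𝓝 0))
    (F : 𝓢(Rn k × Rn m, ℂ)) :
    Tendsto (fun i => R k hM
      (SchwartzMap.compCLMOfContinuousLinearEquiv ℂ (coords U) (squeeze (s i) F))) l (𝓝 0) := by
  refine squeeze_zero (fun i => R_nonneg k hM hγ hmeas _)
    (fun i => R_comp_coords_squeeze_le U hM hγ hmeas (s i) F) ?_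
  rw [← Finset.sum_const_zero (s := (Finset.univ : Finset (Fin m)))]
  refine tendsto_finsetSum _ fun j _ => ?_
  simpa [abs_inv] using ((hs.abs.mul_const _).pow 2).const_mul γ

theorem tendsto_regular_comp_coords_squeeze {ι : Type*} {l : Filter ι} [l.IsCountablyGenerated]
    {s : ι → ℝˣ} (hs : Tendsto (fun i => (s i : ℝ)⁻¹) l (𝓝 0)) {Γ : 𝓢(Rn m, ℂ)}
    (hΓ : ∫ y, Γ y = 1) (f : 𝓢(Rn k, ℂ)) :
    Tendsto (fun i => regular (SchwartzMap.compCLMOfContinuousLinearEquiv ℂ (coords U)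
      (squeeze (s i) (tensor Γ f)))) l
      (𝓝 (rotate U (tensorDelta (Nat.le_add_right k m) (regular f)))) := by
  rw [PointwiseConvergenceCLM.tendsto_iff_forall_tendsto]
  intro φ
  simp only [regular_comp_coords_apply]
  rw [rotate_tensorDelta_apply, regular_apply]
  simp only [restrictFst_apply]
  exact tendsto_integral_mul_squeeze_tensor hs hΓ f _

theorem exists_seq_tendsto_regular_of_mem_G {n k : ℕ} (hk : k ≤ n) {M : Rn n → Rn n → ℂ} {γ : ℝ}
    (hM : IsKernel M) (hγ : ∀ x y, ‖M x y‖ ≤ γ)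
    (hmeas : AEStronglyMeasurable (Function.uncurry M) volume) {T : 𝓢'(Rn n, ℂ)} (hT : T ∈ G hk) :
    ∃ g : ℕ → 𝓢(Rn n, ℂ), Tendsto (fun s => regular (g s)) atTop (𝓝 T) ∧
      Tendsto (fun s => R k hM (g s)) atTop (𝓝 0) := by
  obtain ⟨m, rfl⟩ := Nat.exists_eq_add_of_le hk
  obtain ⟨f, U, rfl⟩ := hT
  have hΓ : ∫ y, ((∫ x, bump (Rn m) x)⁻¹ • bump (Rn m)) y = 1 := by
    simp only [smul_apply, integral_smul]
    exact inv_mul_cancel₀ (integral_bump_ne_zero (Rn m))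
  let s : ℕ → ℝˣ := fun i => .mk0 (i + 1) (by positivity)
  have hs : Tendsto (fun i => (s i : ℝ)⁻¹) atTop (𝓝 0) := by
    simpa [s] using tendsto_one_div_add_atTop_nhds_zero_nat (𝕜 := ℝ)
  exact ⟨_, tendsto_regular_comp_coords_squeeze U hs hΓ f,
    tendsto_R_comp_coords_squeeze U hM hγ hmeas hs _⟩

theorem mem_seqClosure_image_regular_Omega {n k : ℕ} {M : Rn n → Rn n → ℂ} (hM : IsKernel M)
    {ε : ℝ} (hε : 0 < ε) {g : ℕ → 𝓢(Rn n, ℂ)} {T : 𝓢'(Rn n, ℂ)}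
    (hg : Tendsto (fun s => regular (g s)) atTop (𝓝 T))
    (hR : Tendsto (fun s => R k hM (g s)) atTop (𝓝 0)) :
    T ∈ seqClosure (regular '' Omega k hM ε) := by
  obtain ⟨N, hN⟩ := eventually_atTop.1 (hR.eventually_le_const hε)
  exact ⟨fun s => regular (g (s + N)), fun s => ⟨_, hN _ (Nat.le_add_left N s), rfl⟩,
    hg.comp (tendsto_add_atTop_nat N)⟩

end Approximation

theorem exists_orthonormalBasis_tendsto {𝕜 E ι κ : Type*} [RCLike 𝕜] [NormedAddCommGroup E]
    [InnerProductSpace 𝕜 E] [Fintype κ] (l : Ultrafilter ι)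
    (b : ι → OrthonormalBasis κ 𝕜 E) :
    ∃ B : OrthonormalBasis κ 𝕜 E, ∀ j, Tendsto (fun s => b s j) l (𝓝 (B j)) := by
  obtain ⟨s₀⟩ : Nonempty ι := nonempty_of_neBot (l : Filter ι)
  have : FiniteDimensional 𝕜 E := (b s₀).toBasis.finiteDimensional_of_finite
  have : ProperSpace E := FiniteDimensional.proper 𝕜 E
  have hball : ∀ j, ∃ v, Tendsto (fun s => b s j) l (𝓝 v) := fun j => by
    obtain ⟨v, -, hv⟩ := (isCompact_closedBall (0 : E) 1).ultrafilter_le_nhds'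
      (l.map fun s => b s j) (Ultrafilter.mem_map.2 (univ_mem' fun s => by simp))
    exact ⟨v, hv⟩
  choose v hv using hball
  have horth : Orthonormal 𝕜 v := by
    classical
    refine orthonormal_iff_ite.2 fun i j => ?_
    exact tendsto_nhds_unique ((hv i).inner (hv j)) (tendsto_const_nhds.congr fun s =>
      (orthonormal_iff_ite.1 (b s).orthonormal i j).symm)
  obtain ⟨B, hB⟩ := horth.comp _ Subtype.val_injective
    |>.exists_orthonormalBasis_extension_of_card_eq (s := Set.univ)
      (Module.finrank_eq_card_basis (b s₀).toBasis)
  exact ⟨B, fun j => hB j trivial ▸ hv j⟩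

theorem mem_G'_of_apply_mulLinear_normal_eq_zero {k m : ℕ} (U : Rn (k + m) ≃ₗᵢ[ℝ] Rn (k + m))
    {T : 𝓢'(Rn (k + m), ℂ)} (hT : ∀ j ψ, T (mulLinear (innerSL ℝ (normal U j)) ψ) = 0) :
    T ∈ G' (Nat.le_add_right k m) := by
  let S : 𝓢'(Rn k × Rn m, ℂ) := PointwiseConvergenceCLM.precomp ℂ
    (SchwartzMap.compCLMOfContinuousLinearEquiv ℂ (coords U)) T
  have hS (j : Fin m) (ψ : 𝓢(Rn k × Rn m, ℂ)) :
      S (mulLinear (EuclideanSpace.proj j ∘L .snd ℝ (Rn k) (Rn m)) ψ) = 0 := by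
    rw [← hT j (SchwartzMap.compCLMOfContinuousLinearEquiv ℂ (coords U) ψ),
      mulLinear_normal_comp_coords]
    rfl
  have hsum (y : Rn m) :
      ∑ j, (EuclideanSpace.proj j : Rn m →L[ℝ] ℝ) y • EuclideanSpace.single j (1 : ℝ) = y := by
    simpa using! (EuclideanSpace.basisFun (Fin m) ℝ).sum_repr y
  refine ⟨PointwiseConvergenceCLM.precomp ℂ (tensor (bump (Rn m))) S, U, ?_⟩
  ext φ
  rw [rotate_tensorDelta_apply]
  refine Eq.trans ?_ (apply_eq_apply_tensor_restrictFst hsum (bump_apply_zero (Rn m)) hS _)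
  change T φ = T _
  congr 1
  ext x
  simp

section Limit

variable {n : ℕ} {M : Rn n → Rn n → ℂ}

/-- Complex conjugation of Schwartz functions. -/
noncomputable def conjSchwartz : 𝓢(Rn n, ℂ) →L[ℝ] 𝓢(Rn n, ℂ) :=
  SchwartzMap.postcompCLM (𝕜 := ℝ) (Complex.conjCLE : ℂ →L[ℝ] ℂ)

@[simp]
theorem conjSchwartz_apply (ψ : 𝓢(Rn n, ℂ)) (x : Rn n) : conjSchwartz ψ x = conj (ψ x) := rfl

theorem conjSchwartz_conjSchwartz (ψ : 𝓢(Rn n, ℂ)) : conjSchwartz (conjSchwartz ψ) = ψ := by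
  ext x
  simp

theorem tendsto_regular_mulLinear {ι : Type*} {l : Filter ι} {f : ι → 𝓢(Rn n, ℂ)}
    {T : 𝓢'(Rn n, ℂ)} (hf : Tendsto (fun s => regular (f s)) l (𝓝 T)) {v : ι → Rn n} {w : Rn n}
    (hv : Tendsto v l (𝓝 w)) (ψ : 𝓢(Rn n, ℂ)) :
    Tendsto (fun s => regular (f s) (mulLinear (innerSL ℝ (v s)) ψ)) l
      (𝓝 (T (mulLinear (innerSL ℝ w) ψ))) := by
  rw [PointwiseConvergenceCLM.tendsto_iff_forall_tendsto] at hf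
  have hlin (S : 𝓢'(Rn n, ℂ)) (u : Rn n) : S (mulLinear (innerSL ℝ u) ψ) =
      ∑ i, (u i : ℂ) * S (mulLinear (EuclideanSpace.proj i) ψ) := by
    simp only [innerSL_eq_sum_smul_proj, mulLinear_sum_smul, map_sum, map_smul, smul_eq_mul]
  simp only [hlin]
  refine tendsto_finsetSum _ fun i _ => Tendsto.mul ?_ (hf _)
  exact ((Complex.continuous_ofReal.comp (EuclideanSpace.proj i).continuous).tendsto w).comp hv

variable {γ : ℝ} (hM : IsKernel M) (hγ : ∀ x y, ‖M x y‖ ≤ γ)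
  (hmeas : AEStronglyMeasurable (Function.uncurry M) volume)

include hM hγ hmeas

theorem norm_integral_conj_mul_sq_le {φ : Rn n → ℂ} (hφ : MemLp φ 2 volume) {χ : Rn n → ℂ}
    (hχ : χ =ᵐ[volume] integralOp M φ) (h : 𝓢(Rn n, ℂ)) :
    ‖∫ x, conj (χ x) * h x‖ ^ 2 ≤
      (inner ℂ (hM.operator hφ.toLp) hφ.toLp).re * (kernelForm M h h).re := by
  have hinner : ∫ x, conj (χ x) * h x = inner ℂ (hM.operator hφ.toLp) (h.toLp 2) := by
    have hh : h.toLp 2 = (h.memLp 2).toLp := rfl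
    rw [hM.operator_toLp, hh, inner_toLp_toLp]
    exact integral_congr_ae (hχ.mono fun x hx => by simp only [hx])
  have hsymm := hM.isPositive_operator.isSymmetric (h.toLp 2) (h.toLp 2)
  rw [hinner, kernelForm_eq_inner hM hγ hmeas, ← hsymm]
  exact norm_inner_map_sq_le_of_isPositive hM.isPositive_operator _ _

theorem apply_mulLinear_eq_zero_of_tendsto
    (hdense : Dense {ψ : 𝓢(Rn n, ℂ) |
      ∃ φ : Rn n → ℂ, MemLp φ 2 volume ∧ ψ =ᵐ[volume] integralOp M φ})
    {ι : Type*} {l : Filter ι} [l.NeBot] {f : ι → 𝓢(Rn n, ℂ)} {T : 𝓢'(Rn n, ℂ)}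
    (hf : Tendsto (fun s => regular (f s)) l (𝓝 T)) {v : ι → Rn n} {w : Rn n}
    (hv : Tendsto v l (𝓝 w))
    (hq : Tendsto (fun s => inner ℝ (Matrix.toEuclideanLin (gram M (f s)) (v s)) (v s)) l (𝓝 0))
    (ψ : 𝓢(Rn n, ℂ)) : T (mulLinear (innerSL ℝ w) ψ) = 0 := by
  suffices h : (fun χ => T (mulLinear (innerSL ℝ w) (conjSchwartz χ))) = fun _ => 0 by
    simpa only [conjSchwartz_conjSchwartz] using congrFun h (conjSchwartz ψ)
  refine Continuous.ext_on hdense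
    (T.continuous.comp ((mulLinear (innerSL ℝ w)).continuous.comp conjSchwartz.continuous))
    continuous_const ?_
  rintro χ ⟨φ, hφ, hχ⟩
  refine tendsto_nhds_unique (tendsto_regular_mulLinear hf hv (conjSchwartz χ)) ?_
  have hsq : Tendsto (fun s => ‖regular (f s) (mulLinear (innerSL ℝ (v s)) (conjSchwartz χ))‖ ^ 2)
      l (𝓝 0) := by
    refine squeeze_zero (fun _ => by positivity) (fun s => ?_)
      (by simpa using hq.const_mul (inner ℂ (hM.operator hφ.toLp) hφ.toLp).re)
    rw [inner_toEuclideanLin_gram hM hγ hmeas]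
    convert norm_integral_conj_mul_sq_le hM hγ hmeas hφ hχ (mulLinear (innerSL ℝ (v s)) (f s))
      using 3
    rw [regular_apply]
    refine integral_congr_ae (.of_forall fun x => ?_)
    simp only [mulLinear_apply, conjSchwartz_apply]
    ring
  rw [tendsto_zero_iff_norm_tendsto_zero]
  simpa using hsq.sqrt

theorem mem_G'_of_tendsto_R_zero {k : ℕ} (hk : k ≤ n)
    (hdense : Dense {ψ : 𝓢(Rn n, ℂ) |
      ∃ φ : Rn n → ℂ, MemLp φ 2 volume ∧ ψ =ᵐ[volume] integralOp M φ})
    {ι : Type*} {l : Filter ι} [l.NeBot] {f : ι → 𝓢(Rn n, ℂ)} {T : 𝓢'(Rn n, ℂ)}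
    (hf : Tendsto (fun s => regular (f s)) l (𝓝 T))
    (hR : Tendsto (fun s => R k hM (f s)) l (𝓝 0)) : T ∈ G' hk := by
  obtain ⟨m, rfl⟩ := Nat.exists_eq_add_of_le hk
  choose b hb using fun s =>
    exists_orthonormalBasis_inner_le_antiNorm (posSemidef_gram hM hγ hmeas (f s))
  obtain ⟨B, hB⟩ := exists_orthonormalBasis_tendsto (Ultrafilter.of l) b
  refine mem_G'_of_apply_mulLinear_normal_eq_zero B.repr fun j ψ => ?_
  have hnormal : normal B.repr j = B (Fin.natAdd k j) := B.repr_symm_single _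
  rw [hnormal]
  refine apply_mulLinear_eq_zero_of_tendsto hM hγ hmeas hdense (hf.mono_left (Ultrafilter.of_le l))
    (hB _) (squeeze_zero (fun s => ?_) (fun s => hb s _ _ ?_)
      (hR.mono_left (Ultrafilter.of_le l))) ψ
  · exact (Matrix.isPositive_toEuclideanLin_iff.2
      (posSemidef_gram hM hγ hmeas (f s))).re_inner_nonneg_left _
  · simp only [Fin.val_natAdd]; omega

end Limit

theorem IsRegularKernel.stronglyMeasurable_uncurry {n : ℕ} {M : Rn n → Rn n → ℂ}
    (hM : IsRegularKernel M) : StronglyMeasurable (Function.uncurry M) := by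
  refine stronglyMeasurable_uncurry_of_continuous_of_stronglyMeasurable (fun y => ?_) fun x => ?_
  · obtain ⟨ψ, hψ⟩ := hM.schwartz_left y
    rw [← show (ψ : Rn n → ℂ) = fun x => M x y from funext hψ]
    exact ψ.continuous
  · obtain ⟨ψ, hψ⟩ := hM.schwartz_right x
    rw [← show (ψ : Rn n → ℂ) = M x from funext hψ]
    exact ψ.continuous.stronglyMeasurable

end LowDim

theorem theorem4_general {n k : ℕ} (hk : k ≤ n) {M : LowDim.Rn n → LowDim.Rn n → ℂ}
    (hM : LowDim.IsKernel M) (hmeas : AEStronglyMeasurable (Function.uncurry M) volume)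
    (hbdd : ∃ γ : ℝ, ∀ x y, ‖M x y‖ ≤ γ) :
    (∀ T ∈ LowDim.G hk, ∃ g : ℕ → 𝓢(LowDim.Rn n, ℂ),
      Tendsto (fun s => LowDim.regular (g s)) atTop (𝓝 T) ∧
      Tendsto (fun s => LowDim.R k hM (g s)) atTop (𝓝 0)) ∧
    (Dense {ψ : 𝓢(LowDim.Rn n, ℂ) |
        ∃ φ : LowDim.Rn n → ℂ, MemLp φ 2 volume ∧ ψ =ᵐ[volume] LowDim.integralOp M φ} →
      ∀ {ι : Type*} {l : Filter ι} [l.NeBot] {f : ι → 𝓢(LowDim.Rn n, ℂ)} {T : 𝓢'(LowDim.Rn n, ℂ)},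
        Tendsto (fun s => LowDim.regular (f s)) l (𝓝 T) →
        Tendsto (fun s => LowDim.R k hM (f s)) l (𝓝 0) → T ∈ LowDim.G' hk) := by
  obtain ⟨γ, hγ⟩ := hbdd
  exact ⟨fun _ hT => LowDim.exists_seq_tendsto_regular_of_mem_G hk hM hγ hmeas hT,
    fun hdense => LowDim.mem_G'_of_tendsto_R_zero hM hγ hmeas hk hdense⟩

theorem theorem4 {n k : ℕ} (hk : k ≤ n) {M : LowDim.Rn n → LowDim.Rn n → ℂ}
    (hM : LowDim.IsRegularKernel M) :
    (∀ ε : ℝ, 0 < ε →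
      LowDim.G hk ⊆ seqClosure (LowDim.regular '' LowDim.Omega k hM.toIsKernel ε)) ∧
    (∀ (f : ℕ → 𝓢(LowDim.Rn n, ℂ)) (T : 𝓢'(LowDim.Rn n, ℂ)),
      Tendsto (fun s => LowDim.regular (f s)) atTop (𝓝 T) →
      Tendsto (fun s => LowDim.R k hM.toIsKernel (f s)) atTop (𝓝 0) →
      (∃ C : ℝ, ∀ s, |(LowDim.gram M (f s)).trace| ≤ C) →
      T ∈ LowDim.G' hk) := by
  have h := theorem4_general hk hM.toIsKernel
    hM.stronglyMeasurable_uncurry.aestronglyMeasurable hM.bounded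
  refine ⟨fun ε hε T hT => ?_, fun f T hf hR _ => h.2 hM.dense_range hf hR⟩
  obtain ⟨g, hg, hR⟩ := h.1 T hT
  exact LowDim.mem_seqClosure_image_regular_Omega hM.toIsKernel hε hg hR
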